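/- Let $1\le p\le n$ be integers and let $X_1,\ldots,X_{n+1}$ be independent and identically distributed with the $p$-dimensional Gaussian distribution $\mathcal N_p(\mu,\Sigma)$, where the mean $\mu\in\mathbb R^p$ and the positive definite covariance matrix $\Sigma\in\mathbb R^{p\times p}$ are both unknown. Then the minimax risk under squared error for estimating $\log\det\Sigma$ satisfies $$\inf_{\delta}\ \sup_{\mu,\,\Sigma}\ \mathbb E_{\mu,\Sigma}\bigl(\delta(X_1,\ldots,X_{n+1})-\log\det\Sigma\bigr)^2\ \ge\ 2\cdot\frac pn ,$$ where the infimum is taken over all measurable estimators $\delta:(\mathbb R^p)^{n+1}\to\mathbb R$ and the supremum over all $\mu\in\mathbb R^p$ and all positive definite $p\times p$ matrices $\Sigma$. -/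

import Mathlib

open scoped ENNReal

noncomputable section

/-- The law of `n + 1` independent observations, each distributed as the `p`-dimensional
Gaussian `N_p(μ, Σ)` with mean `μ` and covariance matrix `S = Σ`. -/
def gaussianSampleLaw (p n : ℕ) (μ : EuclideanSpace ℝ (Fin p)) (S : Matrix (Fin p) (Fin p) ℝ) :
    MeasureTheory.Measure (Fin (n + 1) → EuclideanSpace ℝ (Fin p)) :=
  MeasureTheory.Measure.pi fun _ => ProbabilityTheory.multivariateGaussian μ S

/-- The mean squared error `E (δ(X₁, …, Xₙ₊₁) - log det Σ)²` of the estimator `δ`, an element of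
`[0, ∞]`, when the observations are i.i.d. `N_p(μ, Σ)` with `S = Σ`. -/
def logDetRisk (p n : ℕ) (δ : (Fin (n + 1) → EuclideanSpace ℝ (Fin p)) → ℝ)
    (μ : EuclideanSpace ℝ (Fin p)) (S : Matrix (Fin p) (Fin p) ℝ) : ℝ≥0∞ :=
  ∫⁻ x, ENNReal.ofReal ((δ x - Real.log S.det) ^ 2) ∂(gaussianSampleLaw p n μ S)

/-- The minimax risk for estimating `log det Σ`: infimum over all measurable functions `δ` of the
sample, supremum over all unknown parameters, i.e. all means `μ` and all positive definite
covariance matrices `S = Σ`. -/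
def logDetMinimaxRisk (p n : ℕ) : ℝ≥0∞ :=
  ⨅ (δ : (Fin (n + 1) → EuclideanSpace ℝ (Fin p)) → ℝ) (_ : Measurable δ),
    ⨆ (μ : EuclideanSpace ℝ (Fin p)) (S : Matrix (Fin p) (Fin p) ℝ) (_ : S.PosDef),
      logDetRisk p n δ μ S

end

/-! The bound already holds on the spherical submodel `Σ = exp (-θ) • 1`, where `log det Σ = -p θ`.
View the sample as one Gaussian vector in dimension `(n + 1) p` and rotate it: `p` coordinates carry
the unknown mean `w = √(n + 1) μ`, and the other `n p` are centred with variance `exp (-θ)`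
(`exists_gaussianSampleLaw_eq_map`). It then suffices to show that `-θ` cannot be estimated there
with worst-case risk below `2 / (n p)`; multiplying by `p ^ 2` gives `2 p / n`.

That bound is a van Trees inequality (`two_div_card_le_of_forall_risk_le`) for a prior proportional
to `h ^ 2`. Differentiating in `θ` alone would give information `(n + 1) p / 2`. Instead the
derivative is taken along the data-dependent field `V = ∂_θ + (y - w) / 2 · ∂_w`, with `y` the
non-centred coordinates: its `w`-part cancels the contribution of `y` to the score, and its
divergence corrects the constant, leaving information `n p / 2`. Since `V θ = 1`, integration by
parts (`integral_weightedScore_mul_add`) relates the error to the score, whose second moment is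
computed in `lintegral_weightedScore_sq`. The prior's own contribution is made at most `ε` by
spreading it out (`exists_contDiff_prior`), and `ε → 0`. -/

/-! ### Compactly supported priors with small energy. -/

open MeasureTheory in
theorem integral_fderiv_apply_eq_zero {E : Type*} [NormedAddCommGroup E] [NormedSpace ℝ E]
    [FiniteDimensional ℝ E] [MeasurableSpace E] [BorelSpace E] (μ : Measure E)
    [μ.IsAddHaarMeasure] {F : E → ℝ} (hF : ContDiff ℝ 1 F) (hc : HasCompactSupport F) (v : E) :
    ∫ x, fderiv ℝ F x v ∂μ = 0 := by
  have hD : Continuous fun x => fderiv ℝ F x v :=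
    (hF.continuous_fderiv one_ne_zero).clm_apply continuous_const
  have hDc : HasCompactSupport fun x => fderiv ℝ F x v := hc.fderiv_apply (𝕜 := ℝ) v
  have := integral_mul_fderiv_eq_neg_fderiv_mul_of_integrable (μ := μ) (f := fun _ : E => (1 : ℝ))
    (g := F) (v := v) (by simp) (by simpa using hD.integrable_of_hasCompactSupport hDc)
    (by simpa using hF.continuous.integrable_of_hasCompactSupport hc)
    (fun x _ => by fun_prop) (fun x _ => hF.differentiable one_ne_zero x)
  simpa using this

open MeasureTheory in
theorem integrable_norm_fderiv_sq {E : Type*} [NormedAddCommGroup E] [NormedSpace ℝ E]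
    [MeasurableSpace E] [BorelSpace E] (μ : Measure E) [IsFiniteMeasureOnCompacts μ]
    {F : E → ℝ} (hF : ContDiff ℝ 1 F) (hc : HasCompactSupport F) :
    Integrable (fun x => ‖fderiv ℝ F x‖ ^ 2) μ := by
  have hD : Continuous fun x => ‖fderiv ℝ F x‖ ^ 2 := by
    have := hF.continuous_fderiv one_ne_zero
    fun_prop
  have hDc : HasCompactSupport fun x => ‖fderiv ℝ F x‖ := (hc.fderiv (𝕜 := ℝ)).norm
  exact hD.integrable_of_hasCompactSupport (hDc.comp_left (g := fun t : ℝ => t ^ 2) (by simp))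

open MeasureTheory in
-- Dilating a bump to `b (c • x)` scales both integrals by the same Jacobian, but the energy gains
-- an extra factor `c ^ 2`, which is made small.
theorem exists_contDiff_small_dirichlet_energy (E : Type*) [NormedAddCommGroup E]
    [NormedSpace ℝ E] [FiniteDimensional ℝ E] [MeasurableSpace E] [BorelSpace E] (μ : Measure E)
    [μ.IsAddHaarMeasure] {ε : ℝ} (hε : 0 < ε) :
    ∃ φ : E → ℝ, ContDiff ℝ 1 φ ∧ HasCompactSupport φ ∧ 0 < ∫ x, φ x ^ 2 ∂μ ∧
      ∫ x, ‖fderiv ℝ φ x‖ ^ 2 ∂μ ≤ ε * ∫ x, φ x ^ 2 ∂μ := by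
  let b : ContDiffBump (0 : E) := ⟨1, 2, one_pos, one_lt_two⟩
  have hb1 : ContDiff ℝ 1 b := b.contDiff
  have hbc : HasCompactSupport b := b.hasCompactSupport
  have hc2 : HasCompactSupport fun x => b x ^ 2 := hbc.comp_left (g := fun t : ℝ => t ^ 2) (by simp)
  have hH : 0 < ∫ x, b x ^ 2 ∂μ := by
    refine (hb1.continuous.pow 2).integral_pos_of_hasCompactSupport_nonneg_nonzero hc2
      (fun x => sq_nonneg _) (x := 0) ?_
    have : b 0 = 1 := b.one_of_mem_closedBall (by simp [b])
    simp [this]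
  set H := ∫ x, b x ^ 2 ∂μ
  set D := ∫ x, ‖fderiv ℝ b x‖ ^ 2 ∂μ
  have hD0 : 0 ≤ D := integral_nonneg fun x => sq_nonneg _
  obtain ⟨c, hc0, hc⟩ : ∃ c : ℝ, 0 < c ∧ c ^ 2 * D ≤ ε * H := by
    -- The `+ 1` keeps the denominator positive without checking that `D ≠ 0`.
    refine ⟨Real.sqrt (ε * H / (D + 1)), by positivity, ?_⟩
    rw [Real.sq_sqrt (by positivity), div_mul_eq_mul_div, div_le_iff₀ (by positivity)]
    nlinarith [mul_pos hε hH]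
  have hder : ∀ x, fderiv ℝ (fun x => b (c • x)) x = c • fderiv ℝ b (c • x) := fun x => by
    rw [fderiv_comp_smul]
  refine ⟨fun x => b (c • x), hb1.comp (contDiff_const_smul c), ?_, ?_, ?_⟩
  · exact hbc.comp_homeomorph (Homeomorph.smulOfNeZero c hc0.ne')
  · rw [Measure.integral_comp_smul μ (fun x => b x ^ 2) c, smul_eq_mul]
    positivity
  · simp_rw [hder, norm_smul, mul_pow]
    rw [integral_const_mul, Measure.integral_comp_smul μ (fun x => ‖fderiv ℝ b x‖ ^ 2) c,
      Measure.integral_comp_smul μ (fun x => b x ^ 2) c, smul_eq_mul, smul_eq_mul]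
    have : 0 ≤ |(c ^ Module.finrank ℝ E)⁻¹| := abs_nonneg _
    have h2 : ‖c‖ ^ 2 = c ^ 2 := by simp
    rw [h2]
    calc c ^ 2 * (|(c ^ Module.finrank ℝ E)⁻¹| * D)
        = |(c ^ Module.finrank ℝ E)⁻¹| * (c ^ 2 * D) := by ring
      _ ≤ |(c ^ Module.finrank ℝ E)⁻¹| * (ε * H) := by gcongr
      _ = _ := by ring

open MeasureTheory in
-- The left side is the information that the prior adds to the second moment of the score. A product
-- `φ(w) η(θ)` works if `η` is chosen first: the unbounded weight `exp (-θ)` then only contributes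
-- the constant `C`, which a flat enough `φ` absorbs.
theorem exists_contDiff_prior (ι : Type*) [Fintype ι] [DecidableEq ι] {ε : ℝ} (hε : 0 < ε) :
    ∃ h : (ι → ℝ) × ℝ → ℝ, ContDiff ℝ 1 h ∧ HasCompactSupport h ∧ 0 < ∫ m, h m ^ 2 ∧
      ∫ m, (4 * fderiv ℝ h m (0, 1) ^ 2 +
        Real.exp (-m.2) * ∑ j, fderiv ℝ h m (Pi.single j 1, 0) ^ 2) ≤ ε * ∫ m, h m ^ 2 := by
  -- Half of `ε` goes to each term: `4 * (ε / 8)` here, and `ε / 2` through `φ` below.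
  obtain ⟨η, hη, hηc, hη0, hηε⟩ := exists_contDiff_small_dirichlet_energy ℝ volume
    (ε := ε / 8) (by positivity)
  set C := ∫ s : ℝ, (Fintype.card ι : ℝ) * (Real.exp (-s) * η s ^ 2)
  have hC0 : 0 ≤ C := integral_nonneg fun s => by positivity
  set K := ∫ s, η s ^ 2
  obtain ⟨φ, hφ, hφc, hφ0, hφε⟩ := exists_contDiff_small_dirichlet_energy (ι → ℝ) volume
    (ε := ε / 2 * K / (C + 1)) (by positivity)
  set J := ∫ s, φ s ^ 2
  have hder : ∀ m : (ι → ℝ) × ℝ, ∀ v : (ι → ℝ) × ℝ,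
      fderiv ℝ (fun m : (ι → ℝ) × ℝ => φ m.1 * η m.2) m v =
        φ m.1 * fderiv ℝ η m.2 v.2 + η m.2 * fderiv ℝ φ m.1 v.1 := by
    intro m v
    have h1 : HasFDerivAt (fun m : (ι → ℝ) × ℝ => φ m.1)
        ((fderiv ℝ φ m.1).comp (ContinuousLinearMap.fst ℝ _ _)) m :=
      (hφ.differentiable one_ne_zero m.1).hasFDerivAt.comp m hasFDerivAt_fst
    have h2 : HasFDerivAt (fun m : (ι → ℝ) × ℝ => η m.2)
        ((fderiv ℝ η m.2).comp (ContinuousLinearMap.snd ℝ _ _)) m :=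
      (hη.differentiable one_ne_zero m.2).hasFDerivAt.comp m hasFDerivAt_snd
    rw [HasFDerivAt.fderiv (h1.fun_mul h2)]
    simp
  have hsq : ∫ m : (ι → ℝ) × ℝ, (φ m.1 * η m.2) ^ 2 = J * K := by
    simp_rw [mul_pow]
    exact integral_prod_mul (fun w => φ w ^ 2) (fun s => η s ^ 2)
  have hφi : Integrable fun w => φ w ^ 2 := by
    have h1 : Continuous fun w => φ w ^ 2 := hφ.continuous.pow 2
    exact h1.integrable_of_hasCompactSupport (hφc.comp_left (g := fun t : ℝ => t ^ 2) (by simp))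
  have hη2c : HasCompactSupport fun s => η s ^ 2 :=
    hηc.comp_left (g := fun t : ℝ => t ^ 2) (by simp)
  have hDφi := integrable_norm_fderiv_sq volume hφ hφc
  have hDηi := integrable_norm_fderiv_sq volume hη hηc
  have hei : Integrable fun s : ℝ => (Fintype.card ι : ℝ) * (Real.exp (-s) * η s ^ 2) := by
    refine Continuous.integrable_of_hasCompactSupport ?_ ?_
    · have := hη.continuous
      fun_prop
    · exact (hη2c.mul_left (f := fun s => Real.exp (-s))).mul_left
        (f := fun _ => (Fintype.card ι : ℝ))
  refine ⟨fun m => φ m.1 * η m.2, ?_, ?_, ?_, ?_⟩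
  · exact (hφ.comp contDiff_fst).mul (hη.comp contDiff_snd)
  · refine HasCompactSupport.of_support_subset_isCompact (hφc.isCompact.prod hηc.isCompact) ?_
    intro m hm
    rw [Function.mem_support] at hm
    exact ⟨subset_tsupport _ (left_ne_zero_of_mul hm), subset_tsupport _ (right_ne_zero_of_mul hm)⟩
  · rw [hsq]; positivity
  · rw [hsq]
    have hi1 : Integrable fun m : (ι → ℝ) × ℝ => φ m.1 ^ 2 * ‖fderiv ℝ η m.2‖ ^ 2 :=
      hφi.mul_prod hDηi
    have hi2 : Integrable fun m : (ι → ℝ) × ℝ =>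
        ‖fderiv ℝ φ m.1‖ ^ 2 * (Fintype.card ι * (Real.exp (-m.2) * η m.2 ^ 2)) :=
      hDφi.mul_prod hei
    have hi : Integrable (fun m : (ι → ℝ) × ℝ => 4 * (φ m.1 ^ 2 * ‖fderiv ℝ η m.2‖ ^ 2) +
        ‖fderiv ℝ φ m.1‖ ^ 2 * (Fintype.card ι * (Real.exp (-m.2) * η m.2 ^ 2))) :=
      (hi1.const_mul 4).add hi2
    calc _ ≤ ∫ m : (ι → ℝ) × ℝ, (4 * (φ m.1 ^ 2 * ‖fderiv ℝ η m.2‖ ^ 2) +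
          ‖fderiv ℝ φ m.1‖ ^ 2 * (Fintype.card ι * (Real.exp (-m.2) * η m.2 ^ 2))) := by
          refine integral_mono_of_nonneg (.of_forall fun m => by simp only [Pi.zero_apply]; positivity) hi
            (.of_forall fun m => ?_)
          simp only [hder]
          have h1 : |fderiv ℝ η m.2 1| ≤ ‖fderiv ℝ η m.2‖ := by
            simpa using (fderiv ℝ η m.2).le_opNorm 1
          have h2 : ∀ j : ι, |fderiv ℝ φ m.1 (Pi.single j 1)| ≤ ‖fderiv ℝ φ m.1‖ := fun j => by
            have h6 := (fderiv ℝ φ m.1).le_opNorm (Pi.single j (1 : ℝ))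
            rwa [Pi.norm_single, norm_one, mul_one] at h6
          have h3 : ∑ j : ι, (φ m.1 * fderiv ℝ η m.2 0 +
              η m.2 * fderiv ℝ φ m.1 (Pi.single j 1)) ^ 2 ≤
              ∑ _j : ι, η m.2 ^ 2 * ‖fderiv ℝ φ m.1‖ ^ 2 := by
            refine Finset.sum_le_sum fun j _ => ?_
            rw [map_zero, mul_zero, zero_add, mul_pow]
            gcongr ?_ * ?_
            exact sq_le_sq.2 (by simpa using h2 j)
          rw [Finset.sum_const, Finset.card_univ, nsmul_eq_mul] at h3
          have h4 : (φ m.1 * fderiv ℝ η m.2 1 + η m.2 * fderiv ℝ φ m.1 0) ^ 2 ≤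
              φ m.1 ^ 2 * ‖fderiv ℝ η m.2‖ ^ 2 := by
            rw [map_zero, mul_zero, add_zero, mul_pow]
            gcongr ?_ * ?_
            exact sq_le_sq.2 (by simpa using h1)
          have h5 := mul_le_mul_of_nonneg_left h3 (Real.exp_pos (-m.2)).le
          linarith
      _ = 4 * (J * ∫ s, ‖fderiv ℝ η s‖ ^ 2) + (∫ w, ‖fderiv ℝ φ w‖ ^ 2) * C := by
          have h1 : ∫ m : (ι → ℝ) × ℝ, φ m.1 ^ 2 * ‖fderiv ℝ η m.2‖ ^ 2 = _ :=
            integral_prod_mul (fun w => φ w ^ 2) (fun s => ‖fderiv ℝ η s‖ ^ 2)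
          have h2 : ∫ m : (ι → ℝ) × ℝ,
              ‖fderiv ℝ φ m.1‖ ^ 2 * (Fintype.card ι * (Real.exp (-m.2) * η m.2 ^ 2)) = _ :=
            integral_prod_mul (fun w => ‖fderiv ℝ φ w‖ ^ 2)
              (fun s => (Fintype.card ι : ℝ) * (Real.exp (-s) * η s ^ 2))
          rw [integral_add (hi1.const_mul 4) hi2, integral_const_mul, h1, h2]
      _ ≤ 4 * (J * (ε / 8 * K)) + (ε / 2 * K / (C + 1) * J) * C := by gcongr
      _ ≤ ε * (J * K) := by
          have : ε / 2 * K / (C + 1) * J * C ≤ ε / 2 * K * J := by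
            rw [div_mul_eq_mul_div, div_mul_eq_mul_div, div_le_iff₀ (by positivity)]
            nlinarith [show 0 ≤ ε / 2 * K * J by positivity]
          linarith

/-! ### The Gaussian linear model and its likelihood. -/

open MeasureTheory in
theorem pi_withDensity_ofReal {ι : Type*} [Fintype ι] {f : ι → ℝ → ℝ}
    (hf0 : ∀ i x, 0 ≤ f i x) (hfm : ∀ i, Measurable (f i)) (hfi : ∀ i, Integrable (f i)) :
    (volume : Measure (ι → ℝ)).withDensity (fun x => ENNReal.ofReal (∏ i, f i (x i))) =
      Measure.pi fun i => (volume : Measure ℝ).withDensity fun x => ENNReal.ofReal (f i x) := by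
  have : ∀ i, IsFiniteMeasure ((volume : Measure ℝ).withDensity fun x => ENNReal.ofReal (f i x)) :=
    fun i => isFiniteMeasure_withDensity_ofReal (hfi i).2
  refine (Measure.pi_eq fun s hs => ?_).symm
  have hm : Measurable fun x : ι → ℝ => ∏ i, f i (x i) :=
    Finset.measurable_prod _ fun i _ => (hfm i).comp (measurable_pi_apply i)
  rw [withDensity_apply _ (MeasurableSet.univ_pi hs), volume_pi, Measure.restrict_pi_pi]
  have hi : Integrable (fun x : ι → ℝ => ∏ i, f i (x i))
      (Measure.pi fun i => (volume : Measure ℝ).restrict (s i)) :=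
    Integrable.fintype_prod fun i => (hfi i).restrict
  rw [← ofReal_integral_eq_lintegral_ofReal hi
    (.of_forall fun x => Finset.prod_nonneg fun i _ => hf0 i _),
    integral_fintype_prod_eq_prod, ENNReal.ofReal_prod_of_nonneg
    fun i _ => integral_nonneg fun x => hf0 i x]
  refine Finset.prod_congr rfl fun i _ => ?_
  rw [withDensity_apply _ (hs i), ofReal_integral_eq_lintegral_ofReal (hfi i).restrict
    (.of_forall fun x => hf0 i x)]

/-- The law of independent real Gaussian observations indexed by `ι ⊕ κ` with common variance
`exp (-m.2)`; those indexed by `ι` have means `m.1`, those indexed by `κ` are centred. -/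
noncomputable def linearModelLaw (ι κ : Type*) [Fintype ι] [Fintype κ] (m : (ι → ℝ) × ℝ) :
    MeasureTheory.Measure (ι ⊕ κ → ℝ) :=
  MeasureTheory.Measure.pi fun i =>
    ProbabilityTheory.gaussianReal (Sum.elim m.1 0 i) (Real.exp (-m.2)).toNNReal

/-- The Lebesgue density of `linearModelLaw`. -/
noncomputable def linearModelLik {ι κ : Type*} [Fintype ι] [Fintype κ] (x : ι ⊕ κ → ℝ)
    (m : (ι → ℝ) × ℝ) : ℝ :=
  (Real.sqrt (2 * Real.pi))⁻¹ ^ (Fintype.card ι + Fintype.card κ) *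
    Real.exp ((Fintype.card ι + Fintype.card κ) / 2 * m.2 - Real.exp m.2 / 2 *
      (∑ j, (x (.inl j) - m.1 j) ^ 2 + ∑ k, x (.inr k) ^ 2))

/-- The score of the linear model along the vector field `∂_θ + (y - w) / 2 · ∂_w`, weighted by the
square root `h` of a prior density. -/
noncomputable def weightedScore {ι κ : Type*} [Fintype ι] [Fintype κ] [DecidableEq ι]
    (h : (ι → ℝ) × ℝ → ℝ) (x : ι ⊕ κ → ℝ) (m : (ι → ℝ) × ℝ) : ℝ :=
  (Fintype.card κ / 2 - Real.exp m.2 / 2 * ∑ k, x (.inr k) ^ 2) * h m +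
    2 * fderiv ℝ h m (0, 1) + ∑ j, (x (.inl j) - m.1 j) * fderiv ℝ h m (Pi.single j 1, 0)

section

variable {ι κ : Type*} [Fintype ι] [Fintype κ]

theorem linearModelLik_nonneg (x : ι ⊕ κ → ℝ) (m : (ι → ℝ) × ℝ) : 0 ≤ linearModelLik x m := by
  unfold linearModelLik; positivity

theorem continuous_linearModelLik :
    Continuous fun q : (ι ⊕ κ → ℝ) × ((ι → ℝ) × ℝ) => linearModelLik q.1 q.2 := by
  unfold linearModelLik; fun_prop

theorem contDiff_linearModelLik (x : ι ⊕ κ → ℝ) : ContDiff ℝ 1 (linearModelLik x) := by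
  unfold linearModelLik; fun_prop

theorem linearModelLik_eq_prod (x : ι ⊕ κ → ℝ) (m : (ι → ℝ) × ℝ) :
    linearModelLik x m = ∏ i, ProbabilityTheory.gaussianPDFReal (Sum.elim m.1 0 i)
      (Real.exp (-m.2)).toNNReal (x i) := by
  have h : ∀ μ y : ℝ, ProbabilityTheory.gaussianPDFReal μ
      (Real.exp (-m.2)).toNNReal y =
      (Real.sqrt (2 * Real.pi))⁻¹ * Real.exp (1 / 2 * m.2 - Real.exp m.2 / 2 * (y - μ) ^ 2) := by
    intro μ y
    have h1 : Real.sqrt (Real.exp (-m.2)) = Real.exp (-m.2 / 2) := by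
      rw [Real.sqrt_eq_iff_mul_self_eq (Real.exp_pos _).le (Real.exp_pos _).le, ← Real.exp_add]
      ring_nf
    rw [ProbabilityTheory.gaussianPDFReal_def]
    simp only [Real.coe_toNNReal _ (Real.exp_pos _).le]
    rw [Real.sqrt_mul (by positivity), h1, mul_inv, ← Real.exp_neg, mul_assoc, ← Real.exp_add,
      Real.exp_neg m.2]
    congr 2
    field_simp
    ring
  simp only [h, Finset.prod_mul_distrib, Finset.prod_const, Finset.card_univ,
    Fintype.card_sum, ← Real.exp_sum]
  rw [linearModelLik]
  congr 2
  simp only [Finset.sum_sub_distrib, Finset.sum_const, Finset.card_univ, Fintype.card_sum,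
    nsmul_eq_mul, ← Finset.mul_sum, Fintype.sum_sum_type, Sum.elim_inl, Sum.elim_inr,
    Pi.zero_apply, sub_zero]
  push_cast
  ring

instance (m : (ι → ℝ) × ℝ) : MeasureTheory.IsProbabilityMeasure (linearModelLaw ι κ m) := by
  unfold linearModelLaw; infer_instance

open MeasureTheory in
theorem linearModelLaw_eq_withDensity (m : (ι → ℝ) × ℝ) :
    linearModelLaw ι κ m = volume.withDensity fun x => ENNReal.ofReal (linearModelLik x m) := by
  simp_rw [linearModelLik_eq_prod]
  rw [pi_withDensity_ofReal (f := fun i x => ProbabilityTheory.gaussianPDFReal (Sum.elim m.1 0 i)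
      (Real.exp (-m.2)).toNNReal x) (fun i x => ProbabilityTheory.gaussianPDFReal_nonneg _ _ x)
    (fun i => ProbabilityTheory.measurable_gaussianPDFReal _ _)
    (fun i => ProbabilityTheory.integrable_gaussianPDFReal _ _), linearModelLaw]
  congr 1
  ext1 i
  rw [ProbabilityTheory.gaussianReal_of_var_ne_zero]
  · rfl
  · exact (Real.toNNReal_pos.2 (Real.exp_pos _)).ne'

open MeasureTheory in
theorem lintegral_linearModelLaw (m : (ι → ℝ) × ℝ) (f : (ι ⊕ κ → ℝ) → ℝ≥0∞) :
    ∫⁻ x, f x ∂(linearModelLaw ι κ m) = ∫⁻ x, f x * ENNReal.ofReal (linearModelLik x m) := by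
  have hm : Measurable fun x : ι ⊕ κ → ℝ => linearModelLik x m :=
    (continuous_linearModelLik.comp (continuous_id.prodMk continuous_const)).measurable
  rw [linearModelLaw_eq_withDensity, lintegral_withDensity_eq_lintegral_mul_non_measurable _
    hm.ennreal_ofReal (.of_forall fun x => ENNReal.ofReal_lt_top)]
  simp [mul_comm]

end

open MeasureTheory ProbabilityTheory


/-! ### Gaussian moments and the second moment of the score. -/

theorem integral_sq_gaussianReal (v : NNReal) : ∫ x, x ^ 2 ∂(gaussianReal 0 v) = v := by
  have := variance_fun_id_gaussianReal (μ := 0) (v := v)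
  rw [variance_eq_integral (by fun_prop)] at this
  simpa using this

theorem integral_pow_four_gaussianReal (v : NNReal) :
    ∫ x, x ^ 4 ∂(gaussianReal 0 v) = 3 * v ^ 2 := by
  have h := iteratedDeriv_mgf_zero (X := id) (μ := gaussianReal 0 v)
    (by simp [integrableExpSet_id_gaussianReal]) 4
  -- The moment is the fourth derivative at `0` of `exp (v t² / 2)`; each differentiation sends the
  -- polynomial prefactor `p` to `p' + v t p`.
  have hd : ∀ (p q : ℝ → ℝ), (∀ t, HasDerivAt p (q t) t) →
      deriv (fun t => p t * Real.exp (v * t ^ 2 / 2)) =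
        fun t => (q t + v * t * p t) * Real.exp (v * t ^ 2 / 2) := by
    intro p q hpq
    ext t
    have h1 : HasDerivAt (fun t : ℝ => v * t ^ 2 / 2) (v * t) t := by
      have := ((hasDerivAt_pow 2 t).const_mul (v : ℝ)).div_const 2
      exact this.congr_deriv (by push_cast; ring)
    refine ((hpq t).fun_mul h1.exp).deriv.trans ?_
    ring
  have e0 : mgf id (gaussianReal 0 v) = fun t => 1 * Real.exp (v * t ^ 2 / 2) := by
    rw [mgf_id_gaussianReal]
    ext t
    simp
  have e1 := hd (fun _ => 1) (fun _ => 0) (fun t => hasDerivAt_const t 1)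
  have e2 := hd (fun t => 0 + v * t * 1) (fun _ => v) (fun t => by
    simpa using (hasDerivAt_id t).const_mul (v : ℝ))
  have e3 := hd (fun t => v + v * t * (0 + v * t * 1)) (fun t => 2 * v ^ 2 * t) (fun t => by
    have := ((hasDerivAt_pow 2 t).const_mul ((v : ℝ) ^ 2)).const_add (v : ℝ)
    rw [show (fun t : ℝ => (v : ℝ) + v * t * (0 + v * t * 1)) = fun t => (v : ℝ) + v ^ 2 * t ^ 2 by
      ext t; ring]
    exact this.congr_deriv (by push_cast; ring))
  have e4 := hd (fun t => 2 * v ^ 2 * t + v * t * (v + v * t * (0 + v * t * 1)))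
    (fun t => 3 * v ^ 2 + 3 * v ^ 3 * t ^ 2) (fun t => by
    have := ((hasDerivAt_id' t).const_mul (3 * (v : ℝ) ^ 2)).fun_add
      ((hasDerivAt_pow 3 t).const_mul ((v : ℝ) ^ 3))
    rw [show (fun t : ℝ => 2 * (v : ℝ) ^ 2 * t + v * t * (v + v * t * (0 + v * t * 1))) =
      fun t => 3 * (v : ℝ) ^ 2 * t + v ^ 3 * t ^ 3 by ext t; ring]
    exact this.congr_deriv (by push_cast; ring))
  simp only [iteratedDeriv_succ, iteratedDeriv_zero, e0, e1, e2, e3, e4] at h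
  simpa using h.symm

theorem memLp_polynomial_gaussianReal (v : NNReal) (a b : ℝ) (μ : ℝ) :
    MemLp (fun x => (x - μ) * a) 2 (gaussianReal μ v) ∧
      MemLp (fun x => a + b * x ^ 2) 2 (gaussianReal μ v) := by
  refine ⟨?_, ?_⟩
  · exact ((memLp_id_gaussianReal' 2 (by simp)).sub (memLp_const μ)).mul_const a
  · have h4 : MemLp (id : ℝ → ℝ) 4 (gaussianReal μ v) := memLp_id_gaussianReal' 4 (by simp)
    have : MemLp (fun x : ℝ => x * x) 2 (gaussianReal μ v) := by
      have : ENNReal.HolderTriple 4 4 2 := ⟨by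
        rw [← two_mul, ← ENNReal.toReal_eq_toReal_iff' (by finiteness) (by finiteness)]
        norm_num⟩
      exact h4.mul' h4
    simp_rw [pow_two]
    exact (memLp_const a).add (this.const_mul b)

variable {ι κ : Type*} [Fintype ι] [Fintype κ]

/-- At a fixed parameter the score is a constant `β` plus independent centred terms, one per
coordinate, so its second moment is `β ^ 2` plus the sum of their variances. Each centred coordinate
contributes `h m ^ 2 / 2`, by the fourth Gaussian moment. -/
theorem lintegral_weightedScore_sq [DecidableEq ι] (h : (ι → ℝ) × ℝ → ℝ) (m : (ι → ℝ) × ℝ) :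
    ∫⁻ x, ENNReal.ofReal (weightedScore h x m ^ 2) ∂(linearModelLaw ι κ m) =
      ENNReal.ofReal (Fintype.card κ / 2 * h m ^ 2 + (4 * fderiv ℝ h m (0, 1) ^ 2 +
        Real.exp (-m.2) * ∑ j, fderiv ℝ h m (Pi.single j 1, 0) ^ 2)) := by
  set β := 2 * fderiv ℝ h m (0, 1) with hβ
  let X : ι ⊕ κ → ℝ → ℝ := Sum.elim (fun j t => (t - m.1 j) * fderiv ℝ h m (Pi.single j 1, 0))
    (fun _ t => h m / 2 + -(Real.exp m.2 / 2 * h m) * t ^ 2)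
  have hX : ∀ x, weightedScore h x m = β + ∑ i, X i (x i) := by
    intro x
    simp only [weightedScore, X, Fintype.sum_sum_type, Sum.elim_inl, Sum.elim_inr,
      Finset.sum_add_distrib, ← Finset.mul_sum, Finset.sum_const, Finset.card_univ, nsmul_eq_mul]
    ring
  have hv : ((Real.exp (-m.2)).toNNReal : ℝ) = Real.exp (-m.2) :=
    Real.coe_toNNReal _ (Real.exp_pos _).le
  have hee : Real.exp m.2 * Real.exp (-m.2) = 1 := by rw [← Real.exp_add]; simp
  have hL : ∀ i, MemLp (X i) 2 (gaussianReal (Sum.elim m.1 0 i) (Real.exp (-m.2)).toNNReal) := by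
    rintro (j | k)
    · exact (memLp_polynomial_gaussianReal _ _ 0 _).1
    · exact (memLp_polynomial_gaussianReal _ _ _ _).2
  have hmean : ∀ i, ∫ t, X i t ∂(gaussianReal (Sum.elim m.1 0 i) (Real.exp (-m.2)).toNNReal) = 0 := by
    rintro (j | k)
    · simp only [X, Sum.elim_inl]
      rw [integral_mul_const, integral_sub (IsGaussian.integrable_fun_id) (integrable_const _)]
      simp
    · simp only [X, Sum.elim_inr, Pi.zero_apply]
      rw [integral_add (integrable_const _), integral_const_mul, integral_sq_gaussianReal, hv]
      · simp only [integral_const, probReal_univ, one_smul]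
        linear_combination (-(h m) / 2) * hee
      · exact ((memLp_id_gaussianReal' 2 (by simp)).integrable_sq).const_mul _
  have hvar : ∀ i, Var[X i; gaussianReal (Sum.elim m.1 0 i) (Real.exp (-m.2)).toNNReal] =
      Sum.elim (fun j => Real.exp (-m.2) * fderiv ℝ h m (Pi.single j 1, 0) ^ 2)
        (fun _ => h m ^ 2 / 2) i := by
    rintro (j | k)
    · simp only [X, Sum.elim_inl]
      rw [variance_mul_const, variance_sub_const (by fun_prop), variance_fun_id_gaussianReal, hv]
    · have h0 := hmean (.inr k)
      rw [variance_eq_integral (hL _).aemeasurable, h0]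
      simp only [X, Sum.elim_inr, Pi.zero_apply, sub_zero]
      have i2 : Integrable (fun x : ℝ => x ^ 2) (gaussianReal 0 (Real.exp (-m.2)).toNNReal) :=
        (memLp_id_gaussianReal' 2 (by simp)).integrable_sq
      have i4 : Integrable (fun x : ℝ => x ^ 4) (gaussianReal 0 (Real.exp (-m.2)).toNNReal) := by
        have := (memLp_polynomial_gaussianReal (Real.exp (-m.2)).toNNReal 0 1 0).2.integrable_sq
        refine this.congr (.of_forall fun x => ?_)
        ring
      have : ∀ x : ℝ, (h m / 2 + -(Real.exp m.2 / 2 * h m) * x ^ 2) ^ 2 =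
          h m ^ 2 / 4 + (-(Real.exp m.2 * h m ^ 2 / 2) * x ^ 2 +
            Real.exp m.2 ^ 2 * h m ^ 2 / 4 * x ^ 4) := fun x => by ring
      simp_rw [this]
      rw [integral_add (integrable_const _) ((i2.const_mul _).fun_add (i4.const_mul _)),
        integral_add (i2.const_mul _) (i4.const_mul _), integral_const_mul, integral_const_mul,
        integral_sq_gaussianReal, integral_pow_four_gaussianReal, hv]
      simp only [integral_const, probReal_univ, one_smul]
      linear_combination (-(h m) ^ 2 / 2 + 3 / 4 * h m ^ 2 *
        (Real.exp m.2 * Real.exp (-m.2) + 1)) * hee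
  obtain ⟨S, hS⟩ : ∃ S : (ι ⊕ κ → ℝ) → ℝ, S = ∑ i, fun x : ι ⊕ κ → ℝ => X i (x i) := ⟨_, rfl⟩
  have hS2 : MemLp S 2 (linearModelLaw ι κ m) := by
    rw [hS]
    refine memLp_finsetSum' _ fun i _ => ?_
    exact (hL i).comp_measurePreserving (measurePreserving_eval _ i)
  have hSmean : ∫ x, S x ∂(linearModelLaw ι κ m) = 0 := by
    simp only [hS, Finset.sum_apply]
    rw [integral_finsetSum]
    · refine Finset.sum_eq_zero fun i _ => ?_
      rw [← hmean i]
      exact integral_comp_eval (hL i).aestronglyMeasurable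
    · exact fun i _ => ((hL i).comp_measurePreserving
        (measurePreserving_eval _ i)).integrable one_le_two
  have hSvar := variance_sum_pi hL
  rw [← hS, show Measure.pi _ = linearModelLaw ι κ m from rfl, variance_eq_integral hS2.aemeasurable,
    hSmean, Finset.sum_congr rfl fun i _ => hvar i] at hSvar
  simp only [Fintype.sum_sum_type, Sum.elim_inl, Sum.elim_inr, Finset.sum_const, Finset.card_univ,
    nsmul_eq_mul, ← Finset.mul_sum, sub_zero] at hSvar
  have hB2 : MemLp (fun x => weightedScore h x m) 2 (linearModelLaw ι κ m) := by
    refine ((memLp_const β).add hS2).ae_eq (.of_forall fun x => ?_)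
    simp [hX, hS]
  rw [← ofReal_integral_eq_lintegral_ofReal hB2.integrable_sq (.of_forall fun x => sq_nonneg _)]
  congr 1
  have : ∀ x, weightedScore h x m ^ 2 = β ^ 2 + (2 * β * S x +
      S x ^ 2) := fun x => by
    simp only [hX, hS, Finset.sum_apply]; ring
  simp_rw [this]
  have hS1 := hS2.integrable one_le_two
  rw [integral_add (integrable_const _) ((hS1.const_mul _).fun_add hS2.integrable_sq),
    integral_add (hS1.const_mul _) hS2.integrable_sq, integral_const_mul, hSmean, hSvar]
  simp only [integral_const, probReal_univ, one_smul, hβ]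
  ring

/-! ### Integration by parts and the van Trees inequality. -/

section
variable {ι κ : Type*} [Fintype ι] [Fintype κ]

theorem fderiv_mul_mul_sq_apply {E : Type*} [NormedAddCommGroup E] [NormedSpace ℝ E]
    {P L h : E → ℝ} {m : E} (hP : DifferentiableAt ℝ P m) (hL : DifferentiableAt ℝ L m)
    (hh : DifferentiableAt ℝ h m) (v : E) :
    fderiv ℝ (fun m => P m * L m * h m ^ 2) m v = fderiv ℝ P m v * L m * h m ^ 2 +
      P m * fderiv ℝ L m v * h m ^ 2 + 2 * P m * L m * h m * fderiv ℝ h m v := by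
  have := (hP.hasFDerivAt.fun_mul hL.hasFDerivAt).fun_mul (hh.hasFDerivAt.pow 2)
  rw [HasFDerivAt.fderiv this]
  simp
  ring

theorem fderiv_linearModelLik_snd (x : ι ⊕ κ → ℝ) (m : (ι → ℝ) × ℝ) :
    fderiv ℝ (linearModelLik x) m (0, 1) = linearModelLik x m *
      ((Fintype.card ι + Fintype.card κ) / 2 - Real.exp m.2 / 2 *
        (∑ j, (x (.inl j) - m.1 j) ^ 2 + ∑ k, x (.inr k) ^ 2)) := by
  rw [← ((contDiff_linearModelLik x).differentiable one_ne_zero m).lineDeriv_eq_fderiv]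
  refine HasLineDerivAt.lineDeriv ?_
  unfold HasLineDerivAt linearModelLik
  simp only [Prod.fst_add, Prod.smul_fst, smul_zero, add_zero, Prod.snd_add, Prod.smul_snd,
    smul_eq_mul, mul_one]
  have h1 : HasDerivAt (fun t : ℝ => m.2 + t) 1 0 := (hasDerivAt_id' 0).const_add _
  have h2 := ((h1.const_mul (((Fintype.card ι : ℝ) + Fintype.card κ) / 2)).fun_sub
    ((h1.exp.div_const 2).mul_const
      (∑ j, (x (.inl j) - m.1 j) ^ 2 + ∑ k, x (.inr k) ^ 2))).exp.const_mul
    ((Real.sqrt (2 * Real.pi))⁻¹ ^ (Fintype.card ι + Fintype.card κ))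
  refine h2.congr_deriv ?_
  simp only [add_zero]
  ring

theorem fderiv_linearModelLik_fst [DecidableEq ι] (x : ι ⊕ κ → ℝ) (m : (ι → ℝ) × ℝ) (j : ι) :
    fderiv ℝ (linearModelLik x) m (Pi.single j 1, 0) = linearModelLik x m *
      (Real.exp m.2 * (x (.inl j) - m.1 j)) := by
  rw [← ((contDiff_linearModelLik x).differentiable one_ne_zero m).lineDeriv_eq_fderiv]
  refine HasLineDerivAt.lineDeriv ?_
  unfold HasLineDerivAt linearModelLik
  simp only [Prod.fst_add, Prod.smul_fst, Prod.snd_add, Prod.smul_snd, mul_zero, add_zero,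
    smul_eq_mul, Pi.add_apply, Pi.smul_apply]
  have h1 : ∀ i : ι, HasDerivAt (fun t : ℝ => (x (.inl i) - (m.1 i + t * Pi.single (M := fun _ : ι => ℝ) j 1 i)) ^ 2)
      (-2 * (x (.inl i) - m.1 i) * Pi.single (M := fun _ : ι => ℝ) j 1 i) 0 := fun i => by
    have := ((((hasDerivAt_id' (0 : ℝ)).mul_const (Pi.single (M := fun _ : ι => ℝ) j 1 i)).const_add
      (m.1 i)).const_sub (x (.inl i))).fun_pow 2
    refine this.congr_deriv ?_
    simp
  have h2 := (HasDerivAt.fun_sum fun i (_ : i ∈ Finset.univ) => h1 i).add_const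
    (∑ k, x (.inr k) ^ 2)
  have h3 := ((h2.const_mul (Real.exp m.2 / 2)).const_sub
    ((Fintype.card ι + Fintype.card κ) / 2 * m.2)).exp.const_mul
    ((Real.sqrt (2 * Real.pi))⁻¹ ^ (Fintype.card ι + Fintype.card κ))
  refine h3.congr_deriv ?_
  have hs : ∑ i, -2 * (x (.inl i) - m.1 i) * Pi.single (M := fun _ : ι => ℝ) j 1 i =
      -2 * (x (.inl j) - m.1 j) := by
    simp [Pi.single_apply]
  simp only [hs, zero_mul, add_zero]
  ring

/-- Integration by parts in the parameters, for a fixed observation. -/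
theorem integral_weightedScore_mul_add [DecidableEq ι] {h : (ι → ℝ) × ℝ → ℝ}
    (hh : ContDiff ℝ 1 h) (hc : HasCompactSupport h) (x : ι ⊕ κ → ℝ) (a : ℝ) :
    ∫ m, ((a + m.2) * h m * weightedScore h x m * linearModelLik x m +
      h m ^ 2 * linearModelLik x m) = 0 := by
  have hL := contDiff_linearModelLik x
  have hc2 : HasCompactSupport fun m => h m ^ 2 :=
    hc.comp_left (g := fun t : ℝ => t ^ 2) (by simp)
  have : (volume : Measure ((ι → ℝ) × ℝ)).IsAddHaarMeasure :=
    Measure.prod.instIsAddHaarMeasure volume volume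
  have key : ∀ P : (ι → ℝ) × ℝ → ℝ, ContDiff ℝ 1 P → ∀ v,
      Integrable (fun m => fderiv ℝ (fun m => P m * linearModelLik x m * h m ^ 2) m v) ∧
      ∫ m, fderiv ℝ (fun m => P m * linearModelLik x m * h m ^ 2) m v = 0 := by
    intro P hP v
    have h1 : ContDiff ℝ 1 fun m => P m * linearModelLik x m * h m ^ 2 := by fun_prop
    have h2 : HasCompactSupport fun m => P m * linearModelLik x m * h m ^ 2 :=
      hc2.mul_left (f := fun m => P m * linearModelLik x m)
    refine ⟨?_, integral_fderiv_apply_eq_zero volume h1 h2 v⟩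
    exact ((h1.continuous_fderiv one_ne_zero).clm_apply
      continuous_const).integrable_of_hasCompactSupport (h2.fderiv_apply (𝕜 := ℝ) v)
  -- Together these are the components of the divergence of `(a + θ) L h² V`. The terms `exp θ (x_j
  -- - w_j)² / 2` cancel between `k0` and `kj`, and differentiating the coefficient `(x_j - w_j) /
  -- 2` gives `-1/2` for each `j`, which cancels `card ι / 2`.
  have k0 := key (fun m => a + m.2) (by fun_prop) (0, 1)
  have kj := fun j : ι => key (fun m => (a + m.2) * ((x (.inl j) - m.1 j) / 2)) (by fun_prop)
    (Pi.single j 1, 0)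
  have hsum : ∫ m, (fderiv ℝ (fun m => (a + m.2) * linearModelLik x m * h m ^ 2) m (0, 1) +
      ∑ j, fderiv ℝ (fun m => (a + m.2) * ((x (.inl j) - m.1 j) / 2) * linearModelLik x m *
        h m ^ 2) m (Pi.single j 1, 0)) = 0 := by
    rw [integral_add k0.1 (integrable_finsetSum _ fun j _ => (kj j).1),
      integral_finsetSum _ fun j _ => (kj j).1, k0.2, Finset.sum_eq_zero fun j _ => (kj j).2,
      add_zero]
  rw [← hsum]
  congr 1
  ext m
  have hLd := hL.differentiable one_ne_zero m
  have hhd := hh.differentiable one_ne_zero m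
  have hP0 : fderiv ℝ (fun m : (ι → ℝ) × ℝ => a + m.2) m (0, 1) = 1 := by
    have : HasFDerivAt (fun m : (ι → ℝ) × ℝ => a + m.2) (ContinuousLinearMap.snd ℝ _ _) m :=
      hasFDerivAt_snd.const_add a
    rw [this.fderiv]; rfl
  have hPj : ∀ j : ι, fderiv ℝ (fun m : (ι → ℝ) × ℝ => (a + m.2) * ((x (.inl j) - m.1 j) / 2)) m
      (Pi.single j 1, 0) = -(a + m.2) / 2 := by
    intro j
    rw [← DifferentiableAt.lineDeriv_eq_fderiv (by fun_prop)]
    refine HasLineDerivAt.lineDeriv ?_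
    unfold HasLineDerivAt
    simp only [Prod.fst_add, Prod.smul_fst, mul_zero, add_zero, Prod.snd_add, Prod.smul_snd,
      smul_eq_mul, Pi.add_apply, Pi.smul_apply, Pi.single_eq_same, mul_one]
    have := ((((hasDerivAt_id' (0 : ℝ)).const_add (m.1 j)).const_sub
      (x (.inl j))).div_const 2).const_mul (a + m.2)
    refine this.congr_deriv ?_
    ring
  rw [fderiv_mul_mul_sq_apply (by fun_prop) hLd hhd, hP0, fderiv_linearModelLik_snd]
  have hterm : ∀ j : ι, fderiv ℝ (fun m => (a + m.2) * ((x (.inl j) - m.1 j) / 2) *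
      linearModelLik x m * h m ^ 2) m (Pi.single j 1, 0) =
      -(a + m.2) / 2 * linearModelLik x m * h m ^ 2 +
      (a + m.2) / 2 * linearModelLik x m * h m ^ 2 * Real.exp m.2 * (x (.inl j) - m.1 j) ^ 2 +
      (a + m.2) * linearModelLik x m * h m *
        ((x (.inl j) - m.1 j) * fderiv ℝ h m (Pi.single j 1, 0)) := by
    intro j
    rw [fderiv_mul_mul_sq_apply (by fun_prop) hLd hhd, hPj, fderiv_linearModelLik_fst]
    ring
  simp only [hterm, Finset.sum_add_distrib, ← Finset.mul_sum, Finset.sum_const, Finset.card_univ,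
    nsmul_eq_mul]
  rw [weightedScore]
  ring

theorem continuous_weightedScore [DecidableEq ι] {h : (ι → ℝ) × ℝ → ℝ} (hh : ContDiff ℝ 1 h) :
    Continuous fun q : (ι ⊕ κ → ℝ) × ((ι → ℝ) × ℝ) => weightedScore h q.1 q.2 := by
  have h1 := hh.continuous
  have h2 : ∀ v, Continuous fun m => fderiv ℝ h m v := fun v =>
    (hh.continuous_fderiv one_ne_zero).clm_apply continuous_const
  have h3 := h2 (0, 1)
  have h4 := fun j : ι => h2 (Pi.single j 1, 0)
  unfold weightedScore
  fun_prop

theorem integrable_priorEnergy [DecidableEq ι] {h : (ι → ℝ) × ℝ → ℝ} (hh : ContDiff ℝ 1 h)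
    (hc : HasCompactSupport h) :
    Integrable fun m => 4 * fderiv ℝ h m (0, 1) ^ 2 +
      Real.exp (-m.2) * ∑ j, fderiv ℝ h m (Pi.single j 1, 0) ^ 2 := by
  have key : ∀ f : (ι → ℝ) × ℝ → ℝ, Continuous f → ∀ v,
      Integrable fun m => f m * fderiv ℝ h m v ^ 2 := by
    intro f hf v
    have h2 : Continuous fun m => fderiv ℝ h m v :=
      (hh.continuous_fderiv one_ne_zero).clm_apply continuous_const
    have h3 : HasCompactSupport fun m => fderiv ℝ h m v ^ 2 :=
      (hc.fderiv_apply (𝕜 := ℝ) v).comp_left (g := fun t : ℝ => t ^ 2) (by simp)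
    exact (hf.mul (h2.pow 2)).integrable_of_hasCompactSupport (h3.mul_left (f := f))
  simp_rw [Finset.mul_sum]
  exact (key _ continuous_const _).add (integrable_finsetSum _ fun j _ => key _ (by fun_prop) _)

theorem lintegral_linearModelLik (m : (ι → ℝ) × ℝ) :
    ∫⁻ x : ι ⊕ κ → ℝ, ENNReal.ofReal (linearModelLik x m) = 1 := by
  have := lintegral_linearModelLaw (κ := κ) m fun _ => 1
  simpa using this.symm

/-- The van Trees inequality in the linear model: a lower bound for the worst-case risk of
estimating the logarithm of the variance. -/
theorem two_div_card_le_of_forall_risk_le [Nonempty κ] {δ : (ι ⊕ κ → ℝ) → ℝ} (hδ : Measurable δ)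
    {R : ℝ≥0∞} (hR : ∀ m, ∫⁻ x, ENNReal.ofReal ((δ x + m.2) ^ 2) ∂(linearModelLaw ι κ m) ≤ R) :
    ENNReal.ofReal (2 / Fintype.card κ) ≤ R := by
  classical
  rcases eq_or_ne R ⊤ with rfl | hRt
  · exact le_top
  obtain ⟨r, hr0, rfl⟩ : ∃ r : ℝ, 0 ≤ r ∧ R = ENNReal.ofReal r :=
    ⟨R.toReal, ENNReal.toReal_nonneg, (ENNReal.ofReal_toReal hRt).symm⟩
  refine ENNReal.ofReal_le_ofReal ?_
  set k : ℝ := (Fintype.card κ : ℝ) with hk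
  have hk0 : 0 < k := by rw [hk]; exact_mod_cast Fintype.card_pos
  -- Letting `ε → 0` gives `2 ≤ k r / 2 + 1`, that is `r ≥ 2 / k`.
  suffices H : ∀ ε : ℝ, 0 < ε → 2 ≤ k / 2 * r + 1 + 2 / k * ε by
    have : (2 : ℝ) ≤ k / 2 * r + 1 := by
      refine le_of_forall_pos_le_add fun ε hε => ?_
      have := H (k / 2 * ε) (by positivity)
      rwa [show 2 / k * (k / 2 * ε) = ε by field_simp] at this
    rw [div_le_iff₀ hk0]
    linarith
  intro ε hε
  obtain ⟨h, hh, hc, hH0, hJ⟩ := exists_contDiff_prior ι hε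
  set H := ∫ m, h m ^ 2
  have hJi := integrable_priorEnergy hh hc
  have hHi : Integrable fun m => h m ^ 2 := by
    have h1 : Continuous fun m => h m ^ 2 := hh.continuous.pow 2
    exact h1.integrable_of_hasCompactSupport (hc.comp_left (g := fun t : ℝ => t ^ 2) (by simp))
  have hHl : ∫⁻ m, ENNReal.ofReal (h m ^ 2) = ENNReal.ofReal H :=
    (ofReal_integral_eq_lintegral_ofReal hHi (.of_forall fun m => sq_nonneg _)).symm
  have hLm : Measurable fun q : (ι ⊕ κ → ℝ) × ((ι → ℝ) × ℝ) => linearModelLik q.1 q.2 :=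
    continuous_linearModelLik.measurable
  have hhm : Measurable h := hh.continuous.measurable
  have hBm : Measurable fun q : (ι ⊕ κ → ℝ) × ((ι → ℝ) × ℝ) => weightedScore h q.1 q.2 :=
    (continuous_weightedScore hh).measurable
  have hL0 : ∀ q : (ι ⊕ κ → ℝ) × ((ι → ℝ) × ℝ), 0 ≤ linearModelLik q.1 q.2 := fun q =>
    linearModelLik_nonneg _ _
  -- Risk and second moment are known parameter by parameter, so by Tonelli a bound with the
  -- parameter integral outside yields joint integrability. This later permits the opposite order of
  -- integration.
  have bound : ∀ (f : (ι ⊕ κ → ℝ) × ((ι → ℝ) × ℝ) → ℝ) (c : ℝ), Measurable f →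
      (∀ q, 0 ≤ f q) → 0 ≤ c →
      ∫⁻ m, ∫⁻ x, ENNReal.ofReal (f (x, m)) ≤ ENNReal.ofReal c →
      Integrable f (volume.prod volume) ∧ ∫ q, f q ∂(volume.prod volume) ≤ c := by
    intro f c hf hf0 hc0 hle
    have e : ∫⁻ q, ENNReal.ofReal (f q) ∂(volume.prod volume) ≤ ENNReal.ofReal c := by
      rw [lintegral_prod_symm' _ hf.ennreal_ofReal]
      exact hle
    have hi : Integrable f (volume.prod volume) :=
      ⟨hf.aestronglyMeasurable, by
        rw [hasFiniteIntegral_iff_ofReal (.of_forall hf0)]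
        exact e.trans_lt ENNReal.ofReal_lt_top⟩
    refine ⟨hi, ?_⟩
    rwa [← ENNReal.ofReal_le_ofReal_iff hc0,
      ofReal_integral_eq_lintegral_ofReal hi (.of_forall hf0)]
  obtain ⟨i1, b1⟩ := bound (fun q => ((δ q.1 + q.2.2) * h q.2) ^ 2 * linearModelLik q.1 q.2)
    (r * H) (by fun_prop) (fun q => mul_nonneg (sq_nonneg _) (hL0 q)) (by positivity) (by
      calc _ ≤ ∫⁻ m, ENNReal.ofReal r * ENNReal.ofReal (h m ^ 2) := by
            refine lintegral_mono fun m => ?_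
            have := hR m
            rw [lintegral_linearModelLaw] at this
            refine le_trans (le_of_eq ?_) (mul_le_mul_left this _)
            rw [← lintegral_mul_const' _ _ ENNReal.ofReal_ne_top]
            refine lintegral_congr fun x => ?_
            rw [← ENNReal.ofReal_mul (sq_nonneg _), ← ENNReal.ofReal_mul
              (mul_nonneg (sq_nonneg _) (hL0 (x, m)))]
            congr 1
            ring
        _ = _ := by
            rw [lintegral_const_mul' _ _ ENNReal.ofReal_ne_top, hHl, ENNReal.ofReal_mul hr0])
  obtain ⟨i2, b2⟩ := bound (fun q => weightedScore h q.1 q.2 ^ 2 * linearModelLik q.1 q.2)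
    ((k / 2 + ε) * H) (by fun_prop) (fun q => mul_nonneg (sq_nonneg _) (hL0 q)) (by positivity) (by
      have e := fun m => lintegral_weightedScore_sq (κ := κ) h m
      simp_rw [lintegral_linearModelLaw, ← ENNReal.ofReal_mul (sq_nonneg _)] at e
      simp only [e]
      rw [← ofReal_integral_eq_lintegral_ofReal ((hHi.const_mul _).fun_add hJi)
        (.of_forall fun m => by simp only [Pi.zero_apply]; positivity)]
      refine ENNReal.ofReal_le_ofReal ?_
      rw [integral_add (hHi.const_mul _) hJi, integral_const_mul, ← hk]
      linarith)
  have l3 : ∫⁻ m, ∫⁻ x : ι ⊕ κ → ℝ, ENNReal.ofReal (h m ^ 2 * linearModelLik x m) =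
      ENNReal.ofReal H := by
    simp_rw [ENNReal.ofReal_mul (sq_nonneg _)]
    simp_rw [lintegral_const_mul' _ _ ENNReal.ofReal_ne_top, lintegral_linearModelLik, mul_one]
    exact hHl
  have m3 : Measurable fun q : (ι ⊕ κ → ℝ) × ((ι → ℝ) × ℝ) =>
      h q.2 ^ 2 * linearModelLik q.1 q.2 := by fun_prop
  obtain ⟨i3, -⟩ := bound (fun q => h q.2 ^ 2 * linearModelLik q.1 q.2) H m3
    (fun q => mul_nonneg (sq_nonneg _) (hL0 q)) hH0.le l3.le
  have e3 : ∫ q : (ι ⊕ κ → ℝ) × ((ι → ℝ) × ℝ), h q.2 ^ 2 * linearModelLik q.1 q.2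
      ∂(volume.prod volume) = H := by
    rw [integral_eq_lintegral_of_nonneg_ae
      (.of_forall fun q => mul_nonneg (sq_nonneg _) (hL0 q)) m3.aestronglyMeasurable,
      lintegral_prod_symm' _ m3.ennreal_ofReal, l3, ENNReal.toReal_ofReal hH0.le]
  have i4 : Integrable (fun q : (ι ⊕ κ → ℝ) × ((ι → ℝ) × ℝ) => (δ q.1 + q.2.2) * h q.2 *
      weightedScore h q.1 q.2 * linearModelLik q.1 q.2) (volume.prod volume) := by
    refine (i1.add i2).mono' (by fun_prop) (.of_forall fun q => ?_)
    rw [Real.norm_eq_abs, abs_mul, abs_of_nonneg (hL0 q), Pi.add_apply, ← add_mul]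
    refine mul_le_mul_of_nonneg_right ?_ (hL0 q)
    rw [abs_le]
    constructor <;> nlinarith [sq_nonneg ((δ q.1 + q.2.2) * h q.2 + weightedScore h q.1 q.2),
      sq_nonneg ((δ q.1 + q.2.2) * h q.2 - weightedScore h q.1 q.2),
      sq_nonneg ((δ q.1 + q.2.2) * h q.2), sq_nonneg (weightedScore h q.1 q.2)]
  have hzero : ∫ q : (ι ⊕ κ → ℝ) × ((ι → ℝ) × ℝ), ((δ q.1 + q.2.2) * h q.2 *
      weightedScore h q.1 q.2 * linearModelLik q.1 q.2 + h q.2 ^ 2 * linearModelLik q.1 q.2)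
      ∂(volume.prod volume) = 0 := by
    -- With the observation held fixed, `δ x` is a constant and plays the role of `a` in the
    -- integration by parts.
    rw [integral_prod _ (i4.fun_add i3)]
    simp only [integral_weightedScore_mul_add hh hc, integral_zero]
  rw [integral_add i4 i3, e3] at hzero
  -- The weighted inequality `-2uv ≤ (k/2) u² + (2/k) v²` replaces Cauchy–Schwarz; the weight `k /
  -- 2` is the limiting information, so nothing is lost as `ε → 0`.
  have hfin : ∫ q : (ι ⊕ κ → ℝ) × ((ι → ℝ) × ℝ), -2 * ((δ q.1 + q.2.2) * h q.2 *
      weightedScore h q.1 q.2 * linearModelLik q.1 q.2) ∂(volume.prod volume) ≤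
      ∫ q : (ι ⊕ κ → ℝ) × ((ι → ℝ) × ℝ),
        (k / 2 * (((δ q.1 + q.2.2) * h q.2) ^ 2 * linearModelLik q.1 q.2) +
        2 / k * (weightedScore h q.1 q.2 ^ 2 * linearModelLik q.1 q.2)) ∂(volume.prod volume) := by
    refine integral_mono (i4.const_mul _) ((i1.const_mul _).fun_add (i2.const_mul _)) fun q => ?_
    have e : k / 2 * ((δ q.1 + q.2.2) * h q.2) ^ 2 + 2 / k * weightedScore h q.1 q.2 ^ 2 +
        2 * ((δ q.1 + q.2.2) * h q.2 * weightedScore h q.1 q.2) =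
        2 / k * (k / 2 * ((δ q.1 + q.2.2) * h q.2) + weightedScore h q.1 q.2) ^ 2 := by
      field_simp
      ring
    have e2 : 0 ≤ 2 / k * (k / 2 * ((δ q.1 + q.2.2) * h q.2) + weightedScore h q.1 q.2) ^ 2 := by
      positivity
    rw [← e] at e2
    have := mul_nonneg e2 (hL0 q)
    simp only
    linarith
  rw [integral_const_mul, integral_add (i1.const_mul _) (i2.const_mul _), integral_const_mul,
    integral_const_mul] at hfin
  have h1 : k / 2 * ∫ q : (ι ⊕ κ → ℝ) × ((ι → ℝ) × ℝ),
      ((δ q.1 + q.2.2) * h q.2) ^ 2 * linearModelLik q.1 q.2 ∂(volume.prod volume) ≤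
      k / 2 * (r * H) := by gcongr
  have h2 : 2 / k * ∫ q : (ι ⊕ κ → ℝ) × ((ι → ℝ) × ℝ),
      weightedScore h q.1 q.2 ^ 2 * linearModelLik q.1 q.2 ∂(volume.prod volume) ≤
      2 / k * ((k / 2 + ε) * H) := by gcongr
  have h3 : 2 * H ≤ (k / 2 * r + 1 + 2 / k * ε) * H := by
    have : 2 / k * ((k / 2 + ε) * H) = (1 + 2 / k * ε) * H := by field_simp
    linarith
  exact le_of_mul_le_mul_right h3 hH0

end

/-! ### Rotating the spherical Gaussian sample into the linear model. -/

open scoped MatrixOrder in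
theorem toEuclideanCLM_sqrt_smul_one {p : ℕ} (θ : ℝ) (x : EuclideanSpace ℝ (Fin p)) :
    Matrix.toEuclideanCLM (𝕜 := ℝ)
      (CFC.sqrt (Real.exp (-θ) • (1 : Matrix (Fin p) (Fin p) ℝ))) x =
      Real.exp (-θ / 2) • x := by
  have h : CFC.sqrt (Real.exp (-θ) • (1 : Matrix (Fin p) (Fin p) ℝ)) =
      Real.exp (-θ / 2) • (1 : Matrix (Fin p) (Fin p) ℝ) := by
    refine CFC.sqrt_unique ?_ ?_
    · rw [smul_mul_smul_comm, mul_one, ← Real.exp_add]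
      ring_nf
    · exact smul_nonneg (Real.exp_pos _).le zero_le_one
  rw [h, map_smul, map_one]
  rfl

/-- Both characteristic functions are `exp (-‖t‖² / 2)`, as `‖t‖²` is additive over the blocks. The
whole sample thus lives in one Euclidean space, where any orthonormal basis gives independent
standard coordinates. -/
theorem pi_stdGaussian_map_toLp {ι E : Type*} [Fintype ι] [NormedAddCommGroup E]
    [InnerProductSpace ℝ E] [FiniteDimensional ℝ E] [MeasurableSpace E] [BorelSpace E] :
    (Measure.pi fun _ : ι => stdGaussian E).map (WithLp.toLp 2) =
      stdGaussian (PiLp 2 fun _ : ι => E) := by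
  have : SecondCountableTopology E := by
    have := FiniteDimensional.proper ℝ E
    infer_instance
  refine Measure.ext_of_charFun ?_
  ext t
  rw [charFun_pi, charFun_stdGaussian]
  simp_rw [charFun_stdGaussian, ← Complex.exp_sum]
  rw [← Finset.sum_div, Finset.sum_neg_distrib, ← Complex.ofReal_pow ‖t‖,
    PiLp.norm_sq_eq_of_L2]
  push_cast
  rfl

theorem linearModelLaw_eq_map {ι κ : Type*} [Fintype ι] [Fintype κ] (m : (ι → ℝ) × ℝ) :
    linearModelLaw ι κ m = (Measure.pi fun _ : ι ⊕ κ => gaussianReal 0 1).map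
      fun z i => Sum.elim m.1 0 i + Real.exp (-m.2 / 2) * z i := by
  have h : ∀ i, (gaussianReal 0 1).map (fun t => Sum.elim m.1 0 i + Real.exp (-m.2 / 2) * t) =
      gaussianReal (Sum.elim m.1 (0 : κ → ℝ) i) (Real.exp (-m.2)).toNNReal := fun i => by
    have := Measure.map_map (μ := gaussianReal 0 1) (g := fun t => Sum.elim m.1 (0 : κ → ℝ) i + t)
      (f := fun t => Real.exp (-m.2 / 2) * t) (by fun_prop) (by fun_prop)
    rw [Function.comp_def] at this
    rw [← this, gaussianReal_map_const_mul, gaussianReal_map_const_add]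
    congr 1
    · simp
    · ext
      rw [Real.coe_toNNReal _ (Real.exp_pos _).le, NNReal.coe_mul, NNReal.coe_one, mul_one,
        NNReal.coe_mk, ← Real.exp_nat_mul]
      congr 1
      push_cast
      ring
  have : ∀ i : ι ⊕ κ, SigmaFinite ((gaussianReal 0 1).map
      fun t => Sum.elim m.1 0 i + Real.exp (-m.2 / 2) * t) := fun i => by
    rw [h]; infer_instance
  rw [Measure.pi_map_pi (f := fun i t => Sum.elim m.1 0 i + Real.exp (-m.2 / 2) * t)
    fun i => by fun_prop, linearModelLaw]
  simp_rw [h]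

/-- A common mean shifts the sample along the diagonal `p`-dimensional subspace only; the remaining
`(n + 1) p - p = n p` basis directions are orthogonal to it and see centred noise. -/
theorem exists_orthonormalBasis_extending_diagonal (n p : ℕ) :
    ∃ b : OrthonormalBasis (Fin p ⊕ Fin (n * p)) ℝ
      (PiLp 2 fun _ : Fin (n + 1) => EuclideanSpace ℝ (Fin p)),
      ∀ j, b (.inl j) = WithLp.toLp 2
        fun _ => (Real.sqrt (n + 1))⁻¹ • EuclideanSpace.single j (1 : ℝ) := by
  have hcard : Module.finrank ℝ (PiLp 2 fun _ : Fin (n + 1) => EuclideanSpace ℝ (Fin p)) =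
      Fintype.card (Fin p ⊕ Fin (n * p)) := by
    rw [(WithLp.linearEquiv 2 ℝ (Fin (n + 1) → EuclideanSpace ℝ (Fin p))).finrank_eq,
      Module.finrank_pi_fintype]
    simp
    ring
  let d : Fin p ⊕ Fin (n * p) → PiLp 2 fun _ : Fin (n + 1) => EuclideanSpace ℝ (Fin p) :=
    Sum.elim (fun j => WithLp.toLp 2
      fun _ => (Real.sqrt (n + 1))⁻¹ • EuclideanSpace.single j (1 : ℝ)) fun _ => 0
  have hinner : ∀ i j, inner ℝ (d (.inl i)) (d (.inl j)) = if i = j then (1 : ℝ) else 0 := by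
    intro i j
    have hs : Real.sqrt (n + 1) * Real.sqrt (n + 1) = n + 1 := Real.mul_self_sqrt (by positivity)
    simp only [d, Sum.elim_inl, PiLp.inner_apply, inner_smul_left, inner_smul_right,
      Finset.sum_const, Finset.card_univ, Fintype.card_fin, nsmul_eq_mul]
    have he : ∑ l, inner ℝ ((EuclideanSpace.single i (1 : ℝ)).ofLp l)
        ((EuclideanSpace.single j (1 : ℝ)).ofLp l) = if i = j then (1 : ℝ) else 0 := by
      simp [eq_comm]
    rw [he, RCLike.conj_to_real]
    push_cast
    have hi : (Real.sqrt (n + 1))⁻¹ * (Real.sqrt (n + 1))⁻¹ * (n + 1) = 1 := by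
      rw [← mul_inv, hs, inv_mul_cancel₀ (by positivity)]
    linear_combination (if i = j then (1 : ℝ) else 0) * hi
  obtain ⟨b, hb⟩ := Orthonormal.exists_orthonormalBasis_extension_of_card_eq hcard (v := d)
    (s := Set.range Sum.inl) (by
      rw [orthonormal_iff_ite]
      rintro ⟨_, i, rfl⟩ ⟨_, j, rfl⟩
      simpa [Set.domRestrict, Subtype.ext_iff] using hinner i j)
  exact ⟨b, fun j => hb _ ⟨j, rfl⟩⟩

open scoped MatrixOrder in
theorem exists_gaussianSampleLaw_eq_map (n p : ℕ) :
    ∃ Φ : (Fin p ⊕ Fin (n * p) → ℝ) → (Fin (n + 1) → EuclideanSpace ℝ (Fin p)), Measurable Φ ∧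
      ∀ m : (Fin p → ℝ) × ℝ, ∃ μ : EuclideanSpace ℝ (Fin p),
        gaussianSampleLaw p n μ (Real.exp (-m.2) • 1) =
          (linearModelLaw (Fin p) (Fin (n * p)) m).map Φ := by
  obtain ⟨b, hb⟩ := exists_orthonormalBasis_extending_diagonal n p
  have hΨ : Measurable fun x : Fin p ⊕ Fin (n * p) → ℝ => ∑ k, x k • b k :=
    (by fun_prop : Continuous fun x : Fin p ⊕ Fin (n * p) → ℝ => ∑ k, x k • b k).measurable
  have hΦ : Measurable fun (x : Fin p ⊕ Fin (n * p) → ℝ) (i : Fin (n + 1)) =>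
      (∑ k, x k • b k) i := by fun_prop
  refine ⟨fun x i => (∑ k, x k • b k) i, hΦ, fun m => ?_⟩
  -- The diagonal vector with all blocks `μ` has coordinates `√(n + 1) μ_j` in the basis, so `μ` is
  -- `m.1` divided by `√(n + 1)`.
  refine ⟨(Real.sqrt (n + 1))⁻¹ • WithLp.toLp 2 m.1, ?_⟩
  set μ : EuclideanSpace ℝ (Fin p) := (Real.sqrt (n + 1))⁻¹ • WithLp.toLp 2 m.1 with hμ
  have hstd : (Measure.pi fun _ : Fin (n + 1) => stdGaussian (EuclideanSpace ℝ (Fin p))) =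
      (Measure.pi fun _ : Fin p ⊕ Fin (n * p) => gaussianReal 0 1).map
        fun z i => (∑ k, z k • b k) i := by
    have h1 := stdGaussian_eq_map_pi_orthonormalBasis b
    rw [← pi_stdGaussian_map_toLp] at h1
    have h2 := congrArg (Measure.map WithLp.ofLp) h1
    rw [Measure.map_map (by fun_prop) (by fun_prop), Measure.map_map (by fun_prop) hΨ] at h2
    rw [show (WithLp.ofLp ∘ WithLp.toLp 2 : (Fin (n + 1) → EuclideanSpace ℝ (Fin p)) → _) = id from
      rfl, Measure.map_id] at h2
    exact h2
  have hmv : ∀ S, multivariateGaussian μ S = (stdGaussian (EuclideanSpace ℝ (Fin p))).map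
    fun x => μ + Matrix.toEuclideanCLM (𝕜 := ℝ) (CFC.sqrt S) x := fun S => rfl
  simp only [gaussianSampleLaw, hmv, toEuclideanCLM_sqrt_smul_one]
  have : SigmaFinite ((stdGaussian (EuclideanSpace ℝ (Fin p))).map
      fun x => μ + Real.exp (-m.2 / 2) • x) := by
    have := Measure.isProbabilityMeasure_map (μ := stdGaussian (EuclideanSpace ℝ (Fin p)))
      (f := fun x => μ + Real.exp (-m.2 / 2) • x) (by fun_prop)
    infer_instance
  rw [← Measure.pi_map_pi (f := fun _ x => μ + Real.exp (-m.2 / 2) • x) fun _ => by fun_prop, hstd,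
    linearModelLaw_eq_map, Measure.map_map (by fun_prop) hΦ, Measure.map_map hΦ (by fun_prop)]
  congr 1
  ext z i j
  have hs : ∑ x, m.1 x * ((Real.sqrt (n + 1))⁻¹ * Pi.single (M := fun _ => ℝ) x 1 j) =
      (Real.sqrt (n + 1))⁻¹ * m.1 j := by
    simp [Pi.single_apply, mul_comm]
  simp [add_smul, Finset.sum_add_distrib, hb, hμ, hs, Finset.mul_sum, mul_assoc, add_assoc]

/-! ### Reduction to the spherical submodel. -/

theorem theorem3 (n p : ℕ) (hp : 1 ≤ p) (hpn : p ≤ n) :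
    ENNReal.ofReal (2 * ((p : ℝ) / (n : ℝ))) ≤ logDetMinimaxRisk p n := by
  have hp0 : (0 : ℝ) < p := by exact_mod_cast hp
  have hn0 : (0 : ℝ) < n := by exact_mod_cast hp.trans hpn
  refine le_iInf₂ fun δ hδ => ?_
  set R := ⨆ (μ : EuclideanSpace ℝ (Fin p)) (S : Matrix (Fin p) (Fin p) ℝ) (_ : S.PosDef),
    logDetRisk p n δ μ S
  obtain ⟨Φ, hΦ, hlaw⟩ := exists_gaussianSampleLaw_eq_map n p
  have : Nonempty (Fin (n * p)) := ⟨⟨0, Nat.mul_pos (hp.trans hpn) hp⟩⟩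
  -- As `log det Σ = -p θ`, the estimator of `-θ` is `δ / p`, and its risk is that of `δ` divided by
  -- `p ^ 2`.
  have key := two_div_card_le_of_forall_risk_le (ι := Fin p) (κ := Fin (n * p))
    (δ := fun x => δ (Φ x) / p) (R := R * ENNReal.ofReal (1 / p ^ 2))
    ((hδ.comp hΦ).div_const _) (fun m => by
      obtain ⟨μ, hμ⟩ := hlaw m
      have hpd : (Real.exp (-m.2) • (1 : Matrix (Fin p) (Fin p) ℝ)).PosDef :=
        Matrix.PosDef.one.smul (Real.exp_pos _)
      have h1 : logDetRisk p n δ μ (Real.exp (-m.2) • 1) ≤ R :=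
        le_iSup_of_le μ (le_iSup₂_of_le _ hpd le_rfl)
      have hdet : Real.log (Real.exp (-m.2) • (1 : Matrix (Fin p) (Fin p) ℝ)).det = -(p * m.2) := by
        rw [Matrix.det_smul, Matrix.det_one, mul_one, Fintype.card_fin, Real.log_pow, Real.log_exp]
        ring
      rw [logDetRisk, hμ, hdet, lintegral_map (by fun_prop) hΦ] at h1
      refine le_trans (le_of_eq ?_) (mul_le_mul_left h1 _)
      rw [← lintegral_mul_const' _ _ ENNReal.ofReal_ne_top]
      refine lintegral_congr fun x => ?_
      rw [← ENNReal.ofReal_mul (sq_nonneg _)]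
      congr 1
      field_simp
      ring)
  have h2 := mul_le_mul_left key (ENNReal.ofReal (p ^ 2))
  rw [mul_assoc, ← ENNReal.ofReal_mul (by positivity), ← ENNReal.ofReal_mul (by positivity)] at h2
  rw [show 1 / (p : ℝ) ^ 2 * p ^ 2 = 1 by field_simp, ENNReal.ofReal_one, mul_one] at h2
  refine le_trans (le_of_eq ?_) h2
  congr 1
  rw [Fintype.card_fin]
  push_cast
  field_simp
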